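/- Let $(M,g)$ be a non-empty smooth Riemannian manifold of dimension $n>2$ with Levi-Civita connection $\nabla$, let $\xi$ be a smooth unit vector field with $\nabla\xi=0$, and put $\pi(X)=g(X,\xi)$. Let $\tilde\nabla$ be the projective semi-symmetric connection $$\tilde\nabla_XY=\nabla_XY+\psi(Y)X+\psi(X)Y+\phi(Y)X-\phi(X)Y,\qquad \phi=\tfrac12\pi,\quad \psi=\tfrac{n-1}{2(n+1)}\pi .$$ For a connection $D$ write $R^D(X,Y)Z=D_XD_YZ-D_YD_XZ-D_{[X,Y]}Z$ and $S^D(Y,Z)=\operatorname{tr}(X\mapsto R^D(X,Y)Z)$; let $R,S$ belong to $\nabla$ and $\tilde R,\tilde S$ to $\tilde\nabla$. Put $\lambda=-\frac{n^2}{(n+1)^2}$ and let $P(X,Y)Z=R(X,Y)Z-\frac1{n-1}\{S(Y,Z)X-S(X,Z)Y\}$ be the projective curvature tensor of $\nabla$. Then: (a) $\tilde R(X,Y)Z=R(X,Y)Z+\lambda\{\pi(X)\pi(Z)Y-\pi(Y)\pi(Z)X\}$ and $\tilde S(Y,Z)=S(Y,Z)-\lambda(n-1)\pi(Y)\pi(Z)$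 for all $X,Y,Z$. (b) For all tangent vectors $X,Y,Z$ at a point: if $\tilde S(Y,Z)=0$, then $S(Y,Z)=\lambda(n-1)\pi(Y)\pi(Z)$; if moreover $\tilde S(X,Z)=0$, then $\tilde R(X,Y)Z=P(X,Y)Z$. (c) In particular, if $M$ is Ricci flat with respect to $\tilde\nabla$, i.e. $\tilde S=0$, then $S=\lambda(n-1)\,\pi\otimes\pi$; $M$ is quasi-Einstein with generator $\xi$ and associated functions $a=0$, $b=\lambda(n-1)$; and $\tilde R=P$. Here $(M,g)$, of dimension $n>2$, is called quasi-Einstein with generator the unit field $\xi$ and smooth functions $a$, $b$ ($b$ nowhere zero) if $R$ and $S$ are not identically zero and $S=a\,g+b\,\pi\otimes\pi$. (The hypothesis $\tilde S=0$ of (c) cannot hold at any point, because $\tilde S(\xi,\xi)=\frac{n^2(n-1)}{(n+1)^2}\ne0$; the content of the result is in (a) and (b).) -/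

import Mathlib

open Bundle FiberBundle
open scoped Manifold ContDiff

noncomputable section

namespace ProjSemiSymm

/-- A linear (affine) connection on an `n`-dimensional manifold: a covariant derivative on the
tangent bundle. In Mathlib's argument order `D Y x v` is `(∇_v Y)(x)`. -/
abbrev LinearConnection (n : ℕ) (M : Type*) [TopologicalSpace M]
    [ChartedSpace (EuclideanSpace ℝ (Fin n)) M] [IsManifold (𝓡 n) ∞ M] :=
  CovariantDerivative (𝓡 n) (EuclideanSpace ℝ (Fin n)) (fun x : M ↦ TangentSpace (𝓡 n) x)

section Curvature

variable {n : ℕ} {M : Type*} [TopologicalSpace M]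
  [ChartedSpace (EuclideanSpace ℝ (Fin n)) M] [IsManifold (𝓡 n) ∞ M]

/-- The vector field `∇_X ∇_Y Z - ∇_Y ∇_X Z - ∇_{[X, Y]} Z`. -/
def curvatureField (D : LinearConnection n M) (X Y Z : Π x : M, TangentSpace (𝓡 n) x) (x : M) :
    TangentSpace (𝓡 n) x :=
  D (fun y ↦ D Z y (Y y)) x (X x) - D (fun y ↦ D Z y (X y)) x (Y x)
    - D Z x (VectorField.mlieBracket (𝓡 n) X Y x)

/-- The curvature tensor `R(u, v)w` of a connection at the point `x`. The tangent vectors are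
extended to vector fields that are smooth near `x` (with constant coordinates in the preferred
chart at `x`); by tensoriality of the curvature of a smooth connection the value does not depend
on the extension. -/
def curvature (D : LinearConnection n M) (x : M) (u v w : TangentSpace (𝓡 n) x) :
    TangentSpace (𝓡 n) x :=
  curvatureField D (extend (EuclideanSpace ℝ (Fin n)) u) (extend (EuclideanSpace ℝ (Fin n)) v)
    (extend (EuclideanSpace ℝ (Fin n)) w) x

/-- A basis of the tangent space at `x`, used only to write a trace. -/
def tangentBasis (n : ℕ) {M : Type*} [TopologicalSpace M]
    [ChartedSpace (EuclideanSpace ℝ (Fin n)) M] (x : M) :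
    Module.Basis (Fin n) ℝ (TangentSpace (𝓡 n) x) :=
  (EuclideanSpace.basisFun (Fin n) ℝ).toBasis

/-- The Ricci tensor `S(v, w) = trace (u ↦ R(u, v)w)` of a connection, the trace being written in
a basis. -/
def ricci (D : LinearConnection n M) (x : M) (v w : TangentSpace (𝓡 n) x) : ℝ :=
  ∑ i, (tangentBasis n x).coord i (curvature D x (tangentBasis n x i) v w)

/-- Ricci flatness with respect to a linear connection. -/
def IsRicciFlat (D : LinearConnection n M) : Prop :=
  ∀ (x : M) (v w : TangentSpace (𝓡 n) x), ricci D x v w = 0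

/-- The Weyl projective curvature tensor
`P(u, v)w = R(u, v)w - (S(v, w)u - S(u, w)v) / (n - 1)`. -/
def projectiveCurvature (D : LinearConnection n M) (x : M) (u v w : TangentSpace (𝓡 n) x) :
    TangentSpace (𝓡 n) x :=
  curvature D x u v w - (1 / ((n : ℝ) - 1)) • (ricci D x v w • u - ricci D x u w • v)

end Curvature

section Riemannian

variable {n : ℕ} {M : Type*} [TopologicalSpace M]
  [ChartedSpace (EuclideanSpace ℝ (Fin n)) M] [IsManifold (𝓡 n) ∞ M]
  [RiemannianBundle (fun x : M ↦ TangentSpace (𝓡 n) x)]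

/-- The Levi-Civita connection: smooth, compatible with the metric and torsion free. -/
structure IsLeviCivita
    [IsContMDiffRiemannianBundle (𝓡 n) ∞ (EuclideanSpace ℝ (Fin n))
      (fun x : M ↦ TangentSpace (𝓡 n) x)]
    (D : LinearConnection n M) : Prop where
  smooth : CovariantDerivative.ContMDiffCovariantDerivative D ∞
  metric :
    haveI : IsContMDiffRiemannianBundle (𝓡 n) 1 (EuclideanSpace ℝ (Fin n))
      (fun x : M ↦ TangentSpace (𝓡 n) x) := IsContMDiffRiemannianBundle.of_le (n := ∞) (by simp)
    D.IsMetricCompatible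
  torsion_free : D.torsion = 0

/-- A smooth vector field of unit length. -/
structure IsUnitField (ξ : Π x : M, TangentSpace (𝓡 n) x) : Prop where
  smooth : ContMDiff (𝓡 n) (𝓡 n).tangent ∞
    (fun x ↦ (⟨x, ξ x⟩ : TangentBundle (𝓡 n) M))
  unit : ∀ x, inner ℝ (ξ x) (ξ x) = 1

/-- A vector field is parallel when `∇ξ = 0`. -/
def IsParallel (D : LinearConnection n M) (ξ : Π x : M, TangentSpace (𝓡 n) x) : Prop :=
  ∀ x, D ξ x = 0

/-- The one-form `π(v) = g(v, ξ)`. -/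
def form (ξ : Π x : M, TangentSpace (𝓡 n) x) (x : M) (v : TangentSpace (𝓡 n) x) : ℝ :=
  inner ℝ v (ξ x)

/-- The one-form `φ = π / 2`. -/
def phi (ξ : Π x : M, TangentSpace (𝓡 n) x) (x : M) (v : TangentSpace (𝓡 n) x) : ℝ :=
  1 / 2 * form ξ x v

/-- The one-form `ψ = (n - 1) / (2 (n + 1)) π`. -/
def psi (ξ : Π x : M, TangentSpace (𝓡 n) x) (x : M) (v : TangentSpace (𝓡 n) x) : ℝ :=
  ((n : ℝ) - 1) / (2 * ((n : ℝ) + 1)) * form ξ x v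

/-- `D'` is the projective semi-symmetric connection attached to `D` and `ξ`:
`∇'_X Y = ∇_X Y + ψ(Y) X + ψ(X) Y + φ(Y) X - φ(X) Y`.
(When `D` is torsion free, `D'` has torsion `π(Y) X - π(X) Y`; and since
`∇'_X X = ∇_X X + 2 ψ(X) X`, both connections have the same geodesics up to parametrization.) -/
def IsProjectiveSemiSymmetric (D D' : LinearConnection n M)
    (ξ : Π x : M, TangentSpace (𝓡 n) x) : Prop :=
  ∀ (Y : Π x : M, TangentSpace (𝓡 n) x) (x : M),
    MDifferentiableAt (𝓡 n) (𝓡 n).tangent (fun y ↦ (⟨y, Y y⟩ : TangentBundle (𝓡 n) M)) x →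
    ∀ v : TangentSpace (𝓡 n) x,
      D' Y x v = D Y x v + psi ξ x (Y x) • v + psi ξ x v • Y x
        + phi ξ x (Y x) • v - phi ξ x v • Y x

/-- A quasi Einstein manifold, where `D` is the Levi-Civita connection: a non-flat Riemannian
manifold of dimension `n > 2` whose Ricci tensor is not identically zero and equals
`a g + b π ⊗ π` with smooth functions `a` and `b ≠ 0`, where `π` is the one-form dual to the unit
vector field `ξ`. -/
structure IsQuasiEinstein (D : LinearConnection n M) (ξ : Π x : M, TangentSpace (𝓡 n) x)
    (a b : M → ℝ) : Prop where
  dim : 2 < n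
  unitField : IsUnitField ξ
  smooth_a : ContMDiff (𝓡 n) 𝓘(ℝ, ℝ) ∞ a
  smooth_b : ContMDiff (𝓡 n) 𝓘(ℝ, ℝ) ∞ b
  b_ne_zero : ∀ x, b x ≠ 0
  not_flat : ∃ (x : M) (u v w : TangentSpace (𝓡 n) x), curvature D x u v w ≠ 0
  ricci_ne_zero : ∃ (x : M) (v w : TangentSpace (𝓡 n) x), ricci D x v w ≠ 0
  ricci_eq : ∀ (x : M) (v w : TangentSpace (𝓡 n) x),
    ricci D x v w = a x * inner ℝ v w + b x * (form ξ x v * form ξ x w)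

end Riemannian

/-- The constant `λ = -n² / (n + 1)²`. -/
def lam (n : ℕ) : ℝ := -((n : ℝ) ^ 2 / ((n : ℝ) + 1) ^ 2)

end ProjSemiSymm

end

namespace ProjSemiSymm

open Filter Topology

variable {n : ℕ} {M : Type*} [TopologicalSpace M]
  [ChartedSpace (EuclideanSpace ℝ (Fin n)) M]

section Form

variable [RiemannianBundle (fun x : M ↦ TangentSpace (𝓡 n) x)]

/-! Collecting `psi` and `phi`, the new connection is `∇_v Y + a π(Y) v + b π(v) Y` with `a =
n/(n+1)` and `b = -1/(n+1)`. Since `ξ` is parallel and `∇` is metric, `π` is parallel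
(`mvfderiv_form`), so differentiating the correction produces no derivative of `π`. After
antisymmetrizing, the terms linear in `a` or `b` cancel because `∇` is torsion free, and the `ab`
and `b²` terms cancel by symmetry. Only `a² = -λ` survives (`curvatureField_of_parallel`), and
tracing gives the Ricci formula. Where the new Ricci tensor vanishes, `S = λ(n-1) π ⊗ π`, and the
Ricci correction in `P` is exactly the `λ` term of the new curvature. -/

@[simp] lemma form_add (ξ : Π x : M, TangentSpace (𝓡 n) x) (x : M) (v w : TangentSpace (𝓡 n) x) :
    form ξ x (v + w) = form ξ x v + form ξ x w := inner_add_left _ _ _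

@[simp] lemma form_sub (ξ : Π x : M, TangentSpace (𝓡 n) x) (x : M) (v w : TangentSpace (𝓡 n) x) :
    form ξ x (v - w) = form ξ x v - form ξ x w := inner_sub_left _ _ _

@[simp] lemma form_smul (ξ : Π x : M, TangentSpace (𝓡 n) x) (x : M) (c : ℝ)
    (v : TangentSpace (𝓡 n) x) : form ξ x (c • v) = c * form ξ x v := real_inner_smul_left _ _ _

end Form

variable [IsManifold (𝓡 n) ∞ M]

section Germs

/-- A section which is smooth on an open neighbourhood of `x` has the germ at `x` of a globally
smooth section. -/
lemma exists_contMDiff_eventuallyEq [T2Space M] {Z : Π x : M, TangentSpace (𝓡 n) x} {x : M}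
    {U : Set M} (hU : IsOpen U) (hx : x ∈ U)
    (hZ : ContMDiffOn (𝓡 n) (𝓡 n).tangent ∞ (fun y ↦ (⟨y, Z y⟩ : TangentBundle (𝓡 n) M)) U) :
    ∃ Z' : Π x : M, TangentSpace (𝓡 n) x,
      ContMDiff (𝓡 n) (𝓡 n).tangent ∞ (fun y ↦ (⟨y, Z' y⟩ : TangentBundle (𝓡 n) M)) ∧
      ∀ᶠ y in 𝓝 x, Z' y = Z y := by
  obtain ⟨f, -, hf⟩ :=
    (SmoothBumpFunction.nhds_basis_tsupport (I := 𝓡 n) x).mem_iff.1 (hU.mem_nhds hx)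
  refine ⟨(f : M → ℝ) • Z, ContMDiffOn.smul_section_of_tsupport f.contMDiff.contMDiffOn hU hf hZ, ?_⟩
  filter_upwards [f.eventuallyEq_one] with y hy
  simp [hy]

lemma mdifferentiableAt_congr_section {Z Z' : Π x : M, TangentSpace (𝓡 n) x} {x : M}
    (hZ : MDifferentiableAt (𝓡 n) (𝓡 n).tangent (fun y ↦ (⟨y, Z y⟩ : TangentBundle (𝓡 n) M)) x)
    (h : ∀ᶠ y in 𝓝 x, Z' y = Z y) :
    MDifferentiableAt (𝓡 n) (𝓡 n).tangent (fun y ↦ (⟨y, Z' y⟩ : TangentBundle (𝓡 n) M)) x :=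
  hZ.congr_of_eventuallyEq (h.mono fun y hy ↦ by simp [hy])

lemma mdifferentiableAt_covariantDerivative_apply [T2Space M] {D : LinearConnection n M}
    (hD : CovariantDerivative.ContMDiffCovariantDerivative D ∞)
    {Y Z : Π x : M, TangentSpace (𝓡 n) x} {x : M} {U : Set M} (hU : IsOpen U) (hx : x ∈ U)
    (hZ : ContMDiffOn (𝓡 n) (𝓡 n).tangent ∞ (fun y ↦ (⟨y, Z y⟩ : TangentBundle (𝓡 n) M)) U)
    (hY : MDifferentiableAt (𝓡 n) (𝓡 n).tangent (fun y ↦ (⟨y, Y y⟩ : TangentBundle (𝓡 n) M)) x) :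
    MDifferentiableAt (𝓡 n) (𝓡 n).tangent
      (fun y ↦ (⟨y, D Z y (Y y)⟩ : TangentBundle (𝓡 n) M)) x := by
  obtain ⟨Z', hZ', hZZ'⟩ := exists_contMDiff_eventuallyEq hU hx hZ
  have hD' := hD.contMDiff.contMDiff (σ := Z') hZ'.contMDiffOn
  have key : MDifferentiableAt (𝓡 n) (𝓡 n).tangent
      (fun y ↦ (⟨y, D Z' y (Y y)⟩ : TangentBundle (𝓡 n) M)) x :=
    MDifferentiableAt.clm_bundle_apply
      (((contMDiffOn_univ.1 hD') x).mdifferentiableAt (by simp)) hY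
  refine mdifferentiableAt_congr_section key ?_
  filter_upwards [hZZ'.eventually_nhds, hU.mem_nhds hx] with y hy hyU
  have hZy := ((hZ.contMDiffAt (hU.mem_nhds hyU)).mdifferentiableAt (by simp))
  have hZ'y := (hZ' y).mdifferentiableAt (by simp)
  rw [D.isCovariantDerivativeOn.congr_of_eventuallyEq hZ'y hZy univ_mem hy]

end Germs

section Riemannian

variable [RiemannianBundle (fun x : M ↦ TangentSpace (𝓡 n) x)]

variable [IsContMDiffRiemannianBundle (𝓡 n) ∞ (EuclideanSpace ℝ (Fin n))
  (fun x : M ↦ TangentSpace (𝓡 n) x)]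

lemma IsUnitField.mdifferentiableAt_form {ξ Z : Π x : M, TangentSpace (𝓡 n) x} {x : M}
    (hξ : IsUnitField ξ)
    (hZ : MDifferentiableAt (𝓡 n) (𝓡 n).tangent (fun y ↦ (⟨y, Z y⟩ : TangentBundle (𝓡 n) M)) x) :
    MDifferentiableAt (𝓡 n) 𝓘(ℝ, ℝ) (fun y ↦ form ξ y (Z y)) x := by
  have : IsContMDiffRiemannianBundle (𝓡 n) 1 (EuclideanSpace ℝ (Fin n))
    (fun x : M ↦ TangentSpace (𝓡 n) x) := IsContMDiffRiemannianBundle.of_le (n := ∞) (by simp)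
  exact MDifferentiableAt.inner_bundle hZ ((hξ.smooth x).mdifferentiableAt (by simp))

/-- The one-form dual to a parallel field is parallel. -/
lemma mvfderiv_form {D : LinearConnection n M} {ξ Z : Π x : M, TangentSpace (𝓡 n) x} {x : M}
    (hD : IsLeviCivita D) (hξ : IsUnitField ξ) (hpar : IsParallel D ξ)
    (hZ : MDifferentiableAt (𝓡 n) (𝓡 n).tangent (fun y ↦ (⟨y, Z y⟩ : TangentBundle (𝓡 n) M)) x)
    (v : TangentSpace (𝓡 n) x) :
    mvfderiv (𝓡 n) (fun y ↦ form ξ y (Z y)) x v = form ξ x (D Z x v) := by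
  have : IsContMDiffRiemannianBundle (𝓡 n) 1 (EuclideanSpace ℝ (Fin n))
    (fun x : M ↦ TangentSpace (𝓡 n) x) := IsContMDiffRiemannianBundle.of_le (n := ∞) (by simp)
  have h := hD.metric.mvfderiv_inner_eq (extend (EuclideanSpace ℝ (Fin n)) v) hZ
    ((hξ.smooth x).mdifferentiableAt (by simp))
  simp only [extend_apply_self, hpar x, zero_apply, inner_zero_right,
    add_zero] at h
  exact h

lemma covariantDerivative_form_smul {D : LinearConnection n M}
    {ξ Y Z : Π x : M, TangentSpace (𝓡 n) x} {x : M}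
    (hD : IsLeviCivita D) (hξ : IsUnitField ξ) (hpar : IsParallel D ξ) (a : ℝ)
    (hY : MDifferentiableAt (𝓡 n) (𝓡 n).tangent (fun y ↦ (⟨y, Y y⟩ : TangentBundle (𝓡 n) M)) x)
    (hZ : MDifferentiableAt (𝓡 n) (𝓡 n).tangent (fun y ↦ (⟨y, Z y⟩ : TangentBundle (𝓡 n) M)) x)
    (v : TangentSpace (𝓡 n) x) :
    MDifferentiableAt (𝓡 n) (𝓡 n).tangent
      (fun y ↦ (⟨y, (a • (fun y ↦ form ξ y (Z y)) • Y) y⟩ : TangentBundle (𝓡 n) M)) x ∧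
    D (a • (fun y ↦ form ξ y (Z y)) • Y) x v
      = (a * form ξ x (Z x)) • D Y x v + (a * form ξ x (D Z x v)) • Y x := by
  have hf := hξ.mdifferentiableAt_form hZ
  have hs := MDifferentiableAt.smul_section hf hY
  refine ⟨MDifferentiableAt.smul_section (f := fun _ ↦ a) mdifferentiableAt_const hs, ?_⟩
  rw [D.isCovariantDerivativeOn.smul_const (s := Set.univ) a hs,
    D.isCovariantDerivativeOn.leibniz (s := Set.univ) hY hf]
  simp only [smul_apply, add_apply,
    ContinuousLinearMap.smulRight_apply, mvfderiv_form hD hξ hpar hZ]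
  module

/-- Curvature of the connection `∇_v Y + a π(Y) v + b π(v) Y`, for `π` dual to a parallel unit
field. -/
lemma curvatureField_of_parallel [T2Space M] {D D' : LinearConnection n M}
    {ξ : Π x : M, TangentSpace (𝓡 n) x} (hD : IsLeviCivita D) (hξ : IsUnitField ξ)
    (hpar : IsParallel D ξ) {a b : ℝ}
    (hD' : ∀ (Y : Π x : M, TangentSpace (𝓡 n) x) (x : M),
      MDifferentiableAt (𝓡 n) (𝓡 n).tangent (fun y ↦ (⟨y, Y y⟩ : TangentBundle (𝓡 n) M)) x →
      ∀ v : TangentSpace (𝓡 n) x,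
        D' Y x v = D Y x v + (a * form ξ x (Y x)) • v + (b * form ξ x v) • Y x)
    {X Y Z : Π x : M, TangentSpace (𝓡 n) x} {x : M} {U : Set M} (hU : IsOpen U) (hx : x ∈ U)
    (hX : MDifferentiableAt (𝓡 n) (𝓡 n).tangent (fun y ↦ (⟨y, X y⟩ : TangentBundle (𝓡 n) M)) x)
    (hY : MDifferentiableAt (𝓡 n) (𝓡 n).tangent (fun y ↦ (⟨y, Y y⟩ : TangentBundle (𝓡 n) M)) x)
    (hZ : ContMDiffOn (𝓡 n) (𝓡 n).tangent ∞ (fun y ↦ (⟨y, Z y⟩ : TangentBundle (𝓡 n) M)) U) :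
    curvatureField D' X Y Z x = curvatureField D X Y Z x
      + a ^ 2 • ((form ξ x (Y x) * form ξ x (Z x)) • X x
        - (form ξ x (X x) * form ξ x (Z x)) • Y x) := by
  have hZd : ∀ y ∈ U, MDifferentiableAt (𝓡 n) (𝓡 n).tangent
      (fun y ↦ (⟨y, Z y⟩ : TangentBundle (𝓡 n) M)) y := fun y hy ↦
    (hZ.contMDiffAt (hU.mem_nhds hy)).mdifferentiableAt (by simp)
  have second : ∀ (W : Π x : M, TangentSpace (𝓡 n) x) (v : TangentSpace (𝓡 n) x),
      MDifferentiableAt (𝓡 n) (𝓡 n).tangent (fun y ↦ (⟨y, W y⟩ : TangentBundle (𝓡 n) M)) x →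
      D' (fun y ↦ D' Z y (W y)) x v = D (fun y ↦ D Z y (W y)) x v
        + (a * form ξ x (Z x)) • D W x v + (a * form ξ x (D Z x v)) • W x
        + (b * form ξ x (W x)) • D Z x v + (b * form ξ x (D W x v)) • Z x
        + (a * form ξ x (D' Z x (W x))) • v + (b * form ξ x v) • D' Z x (W x) := by
    intro W v hW
    have h₁ := mdifferentiableAt_covariantDerivative_apply hD.smooth hU hx hZ hW
    obtain ⟨h₂, e₂⟩ := covariantDerivative_form_smul hD hξ hpar a hW (hZd x hx) v
    obtain ⟨h₃, e₃⟩ := covariantDerivative_form_smul hD hξ hpar b (hZd x hx) hW v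
    have h₁₂ := mdifferentiableAt_add_section h₁ h₂
    have h := mdifferentiableAt_add_section h₁₂ h₃
    -- The formula for `D'` holds only where `Z` is differentiable, so the inner derivative is known
    -- only as a germ; locality of the connection makes this enough.
    have hev : ∀ᶠ y in 𝓝 x, D' Z y (W y) = ((fun y ↦ D Z y (W y))
        + a • (fun y ↦ form ξ y (Z y)) • W + b • (fun y ↦ form ξ y (W y)) • Z) y := by
      filter_upwards [hU.mem_nhds hx] with y hy
      simp [hD' Z y (hZd y hy), smul_smul]
    have h' := mdifferentiableAt_congr_section h hev
    rw [hD' _ x h', D.isCovariantDerivativeOn.congr_of_eventuallyEq h' h univ_mem hev,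
      D.isCovariantDerivativeOn.add (s := Set.univ) h₁₂ h₃,
      D.isCovariantDerivativeOn.add (s := Set.univ) h₁ h₂]
    simp only [add_apply, e₂, e₃]
    module
  -- Writing the bracket as `∇_X Y - ∇_Y X` turns the remaining cancellation into pure module
  -- algebra.
  have tor := CovariantDerivative.torsion_eq_zero_iff D |>.1 hD.torsion_free hX hY
  unfold curvatureField
  rw [second Y (X x) hY, second X (Y x) hX, hD' Z x (hZd x hx), hD' Z x (hZd x hx),
    hD' Z x (hZd x hx), ← tor]
  simp only [form_add, form_sub, form_smul]
  module

theorem curvature_eq_of_isProjectiveSemiSymmetric [T2Space M] {D D' : LinearConnection n M}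
    {ξ : Π x : M, TangentSpace (𝓡 n) x} (hD : IsLeviCivita D) (hξ : IsUnitField ξ)
    (hpar : IsParallel D ξ) (hD' : IsProjectiveSemiSymmetric D D' ξ) (x : M)
    (u v w : TangentSpace (𝓡 n) x) :
    curvature D' x u v w = curvature D x u v w
      + lam n • ((form ξ x u * form ξ x w) • v - (form ξ x v * form ξ x w) • u) := by
  have hn : (n : ℝ) + 1 ≠ 0 := by positivity
  have hD'' : ∀ (Y : Π x : M, TangentSpace (𝓡 n) x) (x : M),
      MDifferentiableAt (𝓡 n) (𝓡 n).tangent (fun y ↦ (⟨y, Y y⟩ : TangentBundle (𝓡 n) M)) x →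
      ∀ v : TangentSpace (𝓡 n) x, D' Y x v = D Y x v + ((n / (n + 1) : ℝ) * form ξ x (Y x)) • v
        + ((-1 / (n + 1) : ℝ) * form ξ x v) • Y x := by
    intro Y x hY v
    -- `a` and `b` are the sum and the difference of the coefficients of `psi` and `phi`.
    have ha : (n / (n + 1) : ℝ) = ((n : ℝ) - 1) / (2 * ((n : ℝ) + 1)) + 1 / 2 := by
      field_simp; ring
    have hb : (-1 / (n + 1) : ℝ) = ((n : ℝ) - 1) / (2 * ((n : ℝ) + 1)) - 1 / 2 := by
      field_simp; ring
    rw [hD' Y x hY v, ha, hb]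
    unfold psi phi
    module
  obtain ⟨s, hs, hZs⟩ := exists_contMDiffOn_extend (k := ∞) (𝓡 n) (EuclideanSpace ℝ (Fin n)) w
  obtain ⟨U, hUs, hU, hx⟩ := mem_nhds_iff.1 hs
  have hZ := hZs.mono hUs
  have h := curvatureField_of_parallel hD hξ hpar hD'' hU hx
    (mdifferentiableAt_extend (𝓡 n) (EuclideanSpace ℝ (Fin n)) u)
    (mdifferentiableAt_extend (𝓡 n) (EuclideanSpace ℝ (Fin n)) v) hZ
  unfold curvature lam
  rw [h]
  simp only [extend_apply_self, div_pow]
  module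

theorem ricci_eq_of_isProjectiveSemiSymmetric [T2Space M] {D D' : LinearConnection n M}
    {ξ : Π x : M, TangentSpace (𝓡 n) x} (hD : IsLeviCivita D) (hξ : IsUnitField ξ)
    (hpar : IsParallel D ξ) (hD' : IsProjectiveSemiSymmetric D D' ξ) (x : M)
    (v w : TangentSpace (𝓡 n) x) :
    ricci D' x v w = ricci D x v w
      - lam n * ((n : ℝ) - 1) * (form ξ x v * form ξ x w) := by
  -- The trace of `u ↦ π(u) v` is `π(v)`; the other term, a multiple of the identity, contributes
  -- the factor `n`.
  have hv : ∑ i, form ξ x (tangentBasis n x i) * (tangentBasis n x).repr v i = form ξ x v := by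
    conv_rhs => rw [← (tangentBasis n x).sum_repr v]
    unfold form
    rw [sum_inner]
    exact Finset.sum_congr rfl fun i _ ↦ by rw [real_inner_smul_left, mul_comm]
  unfold ricci
  simp only [curvature_eq_of_isProjectiveSemiSymmetric hD hξ hpar hD', map_add, map_sub, map_smul,
    Module.Basis.coord_apply, Module.Basis.repr_self, Finsupp.single_eq_same, smul_eq_mul]
  rw [Finset.sum_add_distrib, ← Finset.mul_sum, Finset.sum_sub_distrib]
  simp only [Finset.sum_const, Finset.card_univ, Fintype.card_fin, nsmul_eq_mul]
  have hsum : ∑ i, form ξ x (tangentBasis n x i) * form ξ x w * (tangentBasis n x).repr v i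
      = (∑ i, form ξ x (tangentBasis n x i) * (tangentBasis n x).repr v i) * form ξ x w := by
    rw [Finset.sum_mul]
    exact Finset.sum_congr rfl fun i _ ↦ by ring
  rw [hsum, hv]
  ring

end Riemannian

lemma curvature_ne_zero_of_ricci_ne_zero {D : LinearConnection n M} {x : M}
    {v w : TangentSpace (𝓡 n) x} (h : ricci D x v w ≠ 0) : ∃ u, curvature D x u v w ≠ 0 := by
  by_contra! h'
  exact h (by simp [ricci, h'])

lemma lam_mul_ne_zero {n : ℕ} (hn : 2 < n) : lam n * ((n : ℝ) - 1) ≠ 0 := by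
  have h : (2 : ℝ) < n := by exact_mod_cast hn
  have : (n : ℝ) - 1 ≠ 0 := by linarith
  unfold lam
  refine mul_ne_zero (neg_ne_zero.2 ?_) this
  positivity

end ProjSemiSymm

theorem theorem2p3 {n : ℕ} (hn : 2 < n) {M : Type*} [TopologicalSpace M] [T2Space M] [Nonempty M]
    [ChartedSpace (EuclideanSpace ℝ (Fin n)) M] [IsManifold (𝓡 n) ∞ M]
    [RiemannianBundle (fun x : M ↦ TangentSpace (𝓡 n) x)]
    [IsContMDiffRiemannianBundle (𝓡 n) ∞ (EuclideanSpace ℝ (Fin n))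
      (fun x : M ↦ TangentSpace (𝓡 n) x)]
    (D D' : ProjSemiSymm.LinearConnection n M) (ξ : Π x : M, TangentSpace (𝓡 n) x)
    (hD : ProjSemiSymm.IsLeviCivita D)
    (hξ : ProjSemiSymm.IsUnitField ξ)
    (hpar : ProjSemiSymm.IsParallel D ξ)
    (hD' : ProjSemiSymm.IsProjectiveSemiSymmetric D D' ξ) :
    (∀ (x : M) (u v w : TangentSpace (𝓡 n) x),
      ProjSemiSymm.curvature D' x u v w = ProjSemiSymm.curvature D x u v w
        + ProjSemiSymm.lam n •
          ((ProjSemiSymm.form ξ x u * ProjSemiSymm.form ξ x w) • v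
            - (ProjSemiSymm.form ξ x v * ProjSemiSymm.form ξ x w) • u)) ∧
    (∀ (x : M) (v w : TangentSpace (𝓡 n) x),
      ProjSemiSymm.ricci D' x v w = ProjSemiSymm.ricci D x v w
        - ProjSemiSymm.lam n * ((n : ℝ) - 1)
          * (ProjSemiSymm.form ξ x v * ProjSemiSymm.form ξ x w)) ∧
    (∀ (x : M) (v w : TangentSpace (𝓡 n) x), ProjSemiSymm.ricci D' x v w = 0 →
      ProjSemiSymm.ricci D x v w = ProjSemiSymm.lam n * ((n : ℝ) - 1)
        * (ProjSemiSymm.form ξ x v * ProjSemiSymm.form ξ x w)) ∧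
    (∀ (x : M) (u v w : TangentSpace (𝓡 n) x),
      ProjSemiSymm.ricci D' x v w = 0 → ProjSemiSymm.ricci D' x u w = 0 →
      ProjSemiSymm.curvature D' x u v w = ProjSemiSymm.projectiveCurvature D x u v w) ∧
    (ProjSemiSymm.IsRicciFlat D' →
      (∀ (x : M) (v w : TangentSpace (𝓡 n) x),
        ProjSemiSymm.ricci D x v w = ProjSemiSymm.lam n * ((n : ℝ) - 1)
          * (ProjSemiSymm.form ξ x v * ProjSemiSymm.form ξ x w)) ∧
      ProjSemiSymm.IsQuasiEinstein D ξ (fun _ ↦ 0)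
        (fun _ ↦ ProjSemiSymm.lam n * ((n : ℝ) - 1)) ∧
      (∀ (x : M) (u v w : TangentSpace (𝓡 n) x),
        ProjSemiSymm.curvature D' x u v w = ProjSemiSymm.projectiveCurvature D x u v w)) := by
  have hcurv := ProjSemiSymm.curvature_eq_of_isProjectiveSemiSymmetric hD hξ hpar hD'
  have hric := ProjSemiSymm.ricci_eq_of_isProjectiveSemiSymmetric hD hξ hpar hD'
  have hn' : (n : ℝ) - 1 ≠ 0 := by
    have : (2 : ℝ) < n := by exact_mod_cast hn
    linarith
  have hflat : ∀ (x : M) (v w : TangentSpace (𝓡 n) x), ProjSemiSymm.ricci D' x v w = 0 →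
      ProjSemiSymm.ricci D x v w = ProjSemiSymm.lam n * ((n : ℝ) - 1)
        * (ProjSemiSymm.form ξ x v * ProjSemiSymm.form ξ x w) := fun x v w h ↦ by
    linarith [hric x v w]
  have hproj : ∀ (x : M) (u v w : TangentSpace (𝓡 n) x),
      ProjSemiSymm.ricci D' x v w = 0 → ProjSemiSymm.ricci D' x u w = 0 →
      ProjSemiSymm.curvature D' x u v w = ProjSemiSymm.projectiveCurvature D x u v w := by
    intro x u v w h₁ h₂
    have cancel : ∀ c : ℝ, 1 / ((n : ℝ) - 1) * (ProjSemiSymm.lam n * ((n : ℝ) - 1) * c)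
        = ProjSemiSymm.lam n * c := fun c ↦ by field_simp
    rw [hcurv, ProjSemiSymm.projectiveCurvature, hflat x v w h₁, hflat x u w h₂]
    simp only [smul_sub, smul_smul, cancel]
    module
  refine ⟨hcurv, hric, hflat, hproj, fun h ↦ ⟨fun x v w ↦ hflat x v w (h x v w), ?_,
    fun x u v w ↦ hproj x u v w (h x v w) (h x u w)⟩⟩
  obtain ⟨x⟩ := ‹Nonempty M›
  -- As `π(ξ) = 1`, this value is `λ(n-1)`; nonzero Ricci then forces nonzero curvature, so one
  -- point settles both nonvanishing conditions.
  have hne : ProjSemiSymm.ricci D x (ξ x) (ξ x) ≠ 0 := by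
    rw [hflat x _ _ (h x _ _), ProjSemiSymm.form, hξ.unit x]
    simpa using ProjSemiSymm.lam_mul_ne_zero hn
  obtain ⟨u, hu⟩ := ProjSemiSymm.curvature_ne_zero_of_ricci_ne_zero hne
  exact
    { dim := hn
      unitField := hξ
      smooth_a := contMDiff_const
      smooth_b := contMDiff_const
      b_ne_zero := fun _ ↦ ProjSemiSymm.lam_mul_ne_zero hn
      not_flat := ⟨x, u, _, _, hu⟩
      ricci_ne_zero := ⟨x, _, _, hne⟩
      ricci_eq := fun y v w ↦ by rw [hflat y v w (h y v w)]; ring }
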